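/- Let $\mathcal H$ be a complex Hilbert space, $\mathcal B(\mathcal H)$ the bounded operators on it, $\mathcal I(\mathcal H)=\{V\in\mathcal B(\mathcal H): VV^*V=V\}$ the set of partial isometries and $\mathcal P(\mathcal H)\subset\mathcal I(\mathcal H)$ the set of orthogonal projections. A smooth curve in one of these sets is a $C^\infty$ map from an interval $[a,b]$ ($a<b$) to $\mathcal B(\mathcal H)$ (operator norm) with values in that set. For $V\in\mathcal I(\mathcal H)$ and a tangent vector $\mathcal V$ at $V$ put $$|\mathcal V|_V=\inf\{\max\{\|A\|,\|B\|\}: A=A^*,\ B=B^*\in\mathcal B(\mathcal H),\ iAV-iVB=\mathcal V\}$$ (the quotient metric), and $\ell(\gamma)=\int_a^b|\dot\gamma(t)|_{\gamma(t)}\,dt$ for a smooth curve $\gamma:[a,b]\to\mathcal I(\mathcal H)$. On $\mathcal P(\mathcal H)$ every tangent space carries the operator norm, with length functional $\ell_\infty(\gamma)=\int_a^b\|\dot\gamma(t)\|\,dt$. Let $P_0,P_1\in\mathcal P(\mathcal H)$ satisfy $\dim(R(P_0)\cap N(P_1))=\dim(R(P_1)\cap N(P_0))$ (Hilbert dimensions),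 and let $\delta:[0,1]\to\mathcal P(\mathcal H)$ be a minimal geodesic of $\mathcal P(\mathcal H)$ with $\delta(0)=P_0$ and $\delta(1)=P_1$, in either of the following senses: 1. $\delta(t)=e^{itX}P_0e^{-itX}$ for some $X=X^*\in\mathcal B(\mathcal H)$ with $P_0XP_0=0$, $(1-P_0)X(1-P_0)=0$ and $\|X\|\le\pi/2$; or 2. $\delta$ is a smooth curve and $\ell_\infty(\delta)\le\ell_\infty(\eta)$ for every smooth curve $\eta$ in $\mathcal P(\mathcal H)$ from $P_0$ to $P_1$. Then, for every smooth curve $\gamma:[a,b]\to\mathcal I(\mathcal H)$ with $\gamma(a)=P_0$ and $\gamma(b)=P_1$, $$\ell(\delta)\le\ell(\gamma).$$ -/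

import Mathlib

open scoped ENNReal ContDiff

namespace PartialIsometries

noncomputable section

/-- Hilbert dimension of an inner product space: the least cardinality of an orthonormal set with
dense linear span (for a Hilbert space all such sets have the same cardinality). -/
def hilbertDim (E : Type*) [NormedAddCommGroup E] [InnerProductSpace ℂ E] : Cardinal :=
  sInf {c | ∃ s : Set E, Orthonormal ℂ ((↑) : s → E) ∧
    (Submodule.span ℂ s).topologicalClosure = ⊤ ∧ Cardinal.mk s = c}

variable (H : Type*) [NormedAddCommGroup H] [InnerProductSpace ℂ H] [CompleteSpace H]

/-- The set of partial isometries of `H`. -/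
def partialIsometries : Set (H →L[ℂ] H) := {V | V * star V * V = V}

/-- The set of orthogonal projections of `H`. -/
def projections : Set (H →L[ℂ] H) := {P | IsStarProjection P}

variable {H}

/-- `dim (R(P₀) ∩ N(P₁)) = dim (R(P₁) ∩ N(P₀))`, with Hilbert dimensions. -/
def SameCrossDim (P₀ P₁ : H →L[ℂ] H) : Prop :=
  hilbertDim (LinearMap.range (P₀ : H →ₗ[ℂ] H) ⊓ LinearMap.ker (P₁ : H →ₗ[ℂ] H) :
      Submodule ℂ H) =
    hilbertDim (LinearMap.range (P₁ : H →ₗ[ℂ] H) ⊓ LinearMap.ker (P₀ : H →ₗ[ℂ] H) :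
      Submodule ℂ H)

/-- The quotient Finsler metric of the space of partial isometries: the infimum of
`‖(A, B)‖ = max ‖A‖ ‖B‖` over the selfadjoint liftings `(A, B)` of the tangent vector `T` at `V`. -/
def quotientMetric (V T : H →L[ℂ] H) : ℝ≥0∞ :=
  ⨅ (L : (H →L[ℂ] H) × (H →L[ℂ] H)) (_ : IsSelfAdjoint L.1 ∧ IsSelfAdjoint L.2 ∧
    Complex.I • (L.1 * V) - Complex.I • (V * L.2) = T), ‖L‖ₑ

/-- The Finsler metric of the space of projections: the operator norm on every tangent space. -/
def normMetric (_P T : H →L[ℂ] H) : ℝ≥0∞ := ‖T‖ₑ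

/-- Length of the curve `γ`, defined on `[a, b]`, for the Finsler metric `F`. -/
def curveLength (F : (H →L[ℂ] H) → (H →L[ℂ] H) → ℝ≥0∞) (a b : ℝ) (γ : ℝ → H →L[ℂ] H) : ℝ≥0∞ :=
  ∫⁻ t in Set.Icc a b, F (γ t) (derivWithin γ (Set.Icc a b) t)

/-- `γ` restricts to a smooth curve `[a, b] → M` from `P` to `Q`. -/
structure IsSmoothCurve (M : Set (H →L[ℂ] H)) (a b : ℝ) (P Q : H →L[ℂ] H)
    (γ : ℝ → H →L[ℂ] H) : Prop where
  lt : a < b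
  smooth : ContDiffOn ℝ ∞ γ (Set.Icc a b)
  mem : ∀ t ∈ Set.Icc a b, γ t ∈ M
  left : γ a = P
  right : γ b = Q

/-- `δ : [0, 1] → 𝒫(H)` is the geodesic `δ(t) = exp(itX) P₀ exp(-itX)` from `P₀` to `P₁`, for a
selfadjoint `P₀`-codiagonal operator `X` with `‖X‖ ≤ π / 2`. -/
def IsShortGeodesic (P₀ P₁ : H →L[ℂ] H) (δ : ℝ → H →L[ℂ] H) : Prop :=
  ∃ X : H →L[ℂ] H, IsSelfAdjoint X ∧ P₀ * X * P₀ = 0 ∧ (1 - P₀) * X * (1 - P₀) = 0 ∧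
    ‖X‖ ≤ Real.pi / 2 ∧
    (∀ t ∈ Set.Icc (0 : ℝ) 1, δ t = NormedSpace.exp ((Complex.I * (t : ℂ)) • X) * P₀ *
      NormedSpace.exp (-((Complex.I * (t : ℂ)) • X))) ∧
    δ 1 = P₁

/-- `δ : [0, 1] → 𝒫(H)` is a smooth curve from `P₀` to `P₁` which is a metric geodesic: no smooth
curve of projections joining its endpoints is shorter. -/
def IsMetricGeodesic (P₀ P₁ : H →L[ℂ] H) (δ : ℝ → H →L[ℂ] H) : Prop :=
  IsSmoothCurve (projections H) 0 1 P₀ P₁ δ ∧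
    ∀ (a b : ℝ) (η : ℝ → H →L[ℂ] H), IsSmoothCurve (projections H) a b P₀ P₁ η →
      curveLength normMetric 0 1 δ ≤ curveLength normMetric a b η

end

end PartialIsometries

namespace PartialIsometries

section Sphere

variable {E : Type*} [NormedAddCommGroup E] [InnerProductSpace ℝ E]

local notation "⟪" x ", " y "⟫" => inner ℝ x y

theorem abs_inner_le_of_inner_eq_zero {u v w : E} (hu : ‖u‖ = 1) (hv : ‖v‖ = 1)
    (hw : ⟪v, w⟫ = 0) : |⟪u, w⟫| ≤ √(1 - ⟪u, v⟫ ^ 2) * ‖w‖ := by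
  have h1 : ⟪u, w⟫ = ⟪u - ⟪u, v⟫ • v, w⟫ := by
    rw [inner_sub_left, real_inner_smul_left, hw]; ring
  have h2 : ‖u - ⟪u, v⟫ • v‖ = √(1 - ⟪u, v⟫ ^ 2) := by
    rw [eq_comm, Real.sqrt_eq_iff_eq_sq _ (norm_nonneg _), norm_sub_sq_real,
      real_inner_smul_right, norm_smul, hu, hv, Real.norm_eq_abs, mul_one, sq_abs]
    · ring
    · have := abs_real_inner_le_norm u v
      rw [hu, hv, one_mul] at this
      have := (sq_le_one_iff_abs_le_one ⟪u, v⟫).2 this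
      linarith
  rw [h1, ← h2]
  exact abs_real_inner_le_norm _ _

/-- A curve in the unit sphere is at least as long as the angle between its endpoints. -/
theorem ofReal_arccos_inner_le_lintegral {a b : ℝ} (hab : a < b) {c : ℝ → E}
    (hc : ContDiffOn ℝ 1 c (Set.Icc a b)) (hn : ∀ t ∈ Set.Icc a b, ‖c t‖ = 1) :
    ENNReal.ofReal (Real.arccos ⟪c a, c b⟫) ≤
      ∫⁻ t in Set.Icc a b, ‖derivWithin c (Set.Icc a b) t‖ₑ := by
  have ha : a ∈ Set.Icc a b := Set.left_mem_Icc.2 hab.le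
  have hin : ∀ t ∈ Set.Icc a b, |⟪c a, c t⟫| ≤ 1 := fun t ht => by
    simpa [hn a ha, hn t ht] using abs_real_inner_le_norm (c a) (c t)
  have key : ∀ k ∈ Set.Ioo (0 : ℝ) 1,
      ENNReal.ofReal (Real.arccos (k * ⟪c a, c b⟫) - Real.arccos k) ≤
        ∫⁻ t in Set.Icc a b, ‖derivWithin c (Set.Icc a b) t‖ₑ := by
    rintro k ⟨hk0, hk1⟩
    have hlt : ∀ t ∈ Set.Icc a b, |k * ⟪c a, c t⟫| < 1 := fun t ht => by
      rw [abs_mul, abs_of_pos hk0]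
      nlinarith [hin t ht, abs_nonneg ⟪c a, c t⟫]
    have hne : ∀ t ∈ Set.Icc a b, k * ⟪c a, c t⟫ ≠ -1 ∧ k * ⟪c a, c t⟫ ≠ 1 := fun t ht =>
      ⟨(abs_lt.1 (hlt t ht)).1.ne', (abs_lt.1 (hlt t ht)).2.ne⟩
    have hg : ContDiffOn ℝ 1 (fun t => Real.arccos (k * ⟪c a, c t⟫)) (Set.Icc a b) := fun t ht =>
      ContDiffAt.comp_contDiffWithinAt (g := Real.arccos) (f := fun t => k * ⟪c a, c t⟫) t
        (Real.contDiffAt_arccos (hne t ht).1 (hne t ht).2) (contDiffWithinAt_const.mul (contDiffWithinAt_const.inner ℝ (hc t ht)))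
    have h := enorm_sub_le_lintegral_derivWithin_Icc_of_contDiffOn_Icc hg hab.le
    rw [real_inner_self_eq_norm_sq, hn a ha] at h
    norm_num at h
    refine (Real.ofReal_le_enorm _).trans (h.trans
      (MeasureTheory.setLIntegral_mono' measurableSet_Icc fun t ht => ?_))
    have hd := ((hc.differentiableOn one_ne_zero) t ht).hasDerivWithinAt
    have hu : UniqueDiffWithinAt ℝ (Set.Icc a b) t := uniqueDiffOn_Icc hab t ht
    have horth : ⟪c t, derivWithin c (Set.Icc a b) t⟫ = 0 := by
      have h1 := hd.inner ℝ hd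
      have h2 : HasDerivWithinAt (fun t => ⟪c t, c t⟫) 0 (Set.Icc a b) t :=
        (hasDerivWithinAt_const t (Set.Icc a b) (1 : ℝ)).congr
          (fun s hs => by rw [real_inner_self_eq_norm_sq, hn s hs, one_pow])
          (by rw [real_inner_self_eq_norm_sq, hn t ht, one_pow])
      have h3 := hu.eq_deriv _ h1 h2
      rw [real_inner_comm (c t)] at h3
      linarith
    have hi : HasDerivWithinAt (fun t => k * ⟪c a, c t⟫)
        (k * ⟪c a, derivWithin c (Set.Icc a b) t⟫) (Set.Icc a b) t := by
      simpa using ((hasDerivWithinAt_const t (Set.Icc a b) (c a)).inner ℝ hd).const_mul k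
    have hcomp := (Real.hasDerivAt_arccos (hne t ht).1 (hne t ht).2).comp_hasDerivWithinAt t hi
    have hcomp' : derivWithin (fun t => Real.arccos (k * ⟪c a, c t⟫)) (Set.Icc a b) t = _ :=
      hcomp.derivWithin hu
    rw [hcomp']
    refine enorm_le_iff_norm_le.2 ?_
    have hs : 0 < 1 - (k * ⟪c a, c t⟫) ^ 2 := by
      have := (sq_lt_one_iff_abs_lt_one (k * ⟪c a, c t⟫)).2 (hlt t ht)
      linarith
    have hb := abs_inner_le_of_inner_eq_zero (hn a ha) (hn t ht) horth
    have hsq : k * √(1 - ⟪c a, c t⟫ ^ 2) ≤ √(1 - (k * ⟪c a, c t⟫) ^ 2) := by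
      refine Real.le_sqrt_of_sq_le ?_
      rw [mul_pow, Real.sq_sqrt]
      · nlinarith
      · linarith [(sq_le_one_iff_abs_le_one ⟪c a, c t⟫).2 (hin t ht)]
    rw [Real.norm_eq_abs, abs_mul, abs_neg, abs_of_nonneg (by positivity), one_div_mul_eq_div,
      div_le_iff₀ (Real.sqrt_pos.2 hs), abs_mul, abs_of_pos hk0]
    calc k * |⟪c a, derivWithin c (Set.Icc a b) t⟫|
        ≤ k * (√(1 - ⟪c a, c t⟫ ^ 2) * ‖derivWithin c (Set.Icc a b) t‖) := by gcongr
      _ = (k * √(1 - ⟪c a, c t⟫ ^ 2)) * ‖derivWithin c (Set.Icc a b) t‖ := by ring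
      _ ≤ √(1 - (k * ⟪c a, c t⟫) ^ 2) * ‖derivWithin c (Set.Icc a b) t‖ := by gcongr
      _ = _ := mul_comm _ _
  have hcont : Continuous fun k : ℝ =>
      ENNReal.ofReal (Real.arccos (k * ⟪c a, c b⟫) - Real.arccos k) := by
    have := Real.continuous_arccos
    exact ENNReal.continuous_ofReal.comp (by fun_prop)
  have hlim := (hcont.tendsto 1).mono_left (nhdsWithin_le_nhds (s := Set.Iio 1))
  simp only [one_mul, Real.arccos_one, sub_zero] at hlim
  refine le_of_tendsto hlim ?_
  filter_upwards [Ioo_mem_nhdsLT (zero_lt_one' ℝ)] with k hk using key k hk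

end Sphere

variable {H : Type*} [NormedAddCommGroup H] [InnerProductSpace ℂ H]

section Curves

variable {a b : ℝ} {P Q : H →L[ℂ] H} {η γ : ℝ → H →L[ℂ] H}

theorem curveLength_mono {F G : (H →L[ℂ] H) → (H →L[ℂ] H) → ℝ≥0∞}
    (h : ∀ t ∈ Set.Icc a b, F (η t) (derivWithin η (Set.Icc a b) t) ≤
      G (γ t) (derivWithin γ (Set.Icc a b) t)) :
    curveLength F a b η ≤ curveLength G a b γ :=
  MeasureTheory.setLIntegral_mono' measurableSet_Icc h

theorem IsSmoothCurve.hasDerivWithinAt {M : Set (H →L[ℂ] H)} (h : IsSmoothCurve M a b P Q η)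
    {t : ℝ} (ht : t ∈ Set.Icc a b) :
    HasDerivWithinAt η (derivWithin η (Set.Icc a b) t) (Set.Icc a b) t :=
  (h.smooth.differentiableOn (by simp) t ht).hasDerivWithinAt

end Curves

variable [CompleteSpace H]

/-- The symmetry `2P - 1` of a projection squares to the identity. -/
theorem symmetry_mul_self {P : H →L[ℂ] H} (hP : P ∈ projections H) :
    ((2 : ℝ) • P - 1) * ((2 : ℝ) • P - 1) = 1 := by
  have h : P * P = P := hP.isIdempotentElem
  simp only [mul_sub, sub_mul, smul_mul_assoc, mul_smul_comm, h, mul_one, one_mul]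
  module

theorem isSelfAdjoint_symmetry {P : H →L[ℂ] H} (hP : P ∈ projections H) :
    IsSelfAdjoint ((2 : ℝ) • P - 1) :=
  ((IsSelfAdjoint.all (2 : ℝ)).smul hP.isSelfAdjoint).sub (.one _)

theorem norm_symmetry_apply {P : H →L[ℂ] H} (hP : P ∈ projections H) (x : H) :
    ‖((2 : ℝ) • P - 1) x‖ = ‖x‖ := by
  have hu : (2 : ℝ) • P - 1 ∈ unitary (H →L[ℂ] H) := by
    rw [Unitary.mem_iff, (isSelfAdjoint_symmetry hP).star_eq, symmetry_mul_self hP]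
    exact ⟨rfl, rfl⟩
  exact ContinuousLinearMap.norm_map_of_mem_unitary hu x

theorem norm_symmetry_le {P : H →L[ℂ] H} (hP : P ∈ projections H) : ‖(2 : ℝ) • P - 1‖ ≤ 1 :=
  ContinuousLinearMap.opNorm_le_bound _ zero_le_one fun x => by
    rw [norm_symmetry_apply hP, one_mul]

theorem norm_commutator_le {P : H →L[ℂ] H} (hP : P ∈ projections H) (A : H →L[ℂ] H) :
    ‖A * P - P * A‖ ≤ ‖A‖ := by
  have h : A * P - P * A =
      (2⁻¹ : ℝ) • (A * ((2 : ℝ) • P - 1) - ((2 : ℝ) • P - 1) * A) := by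
    simp only [mul_sub, sub_mul, smul_mul_assoc, mul_smul_comm, mul_one, one_mul]
    module
  have h1 := norm_mul_le A ((2 : ℝ) • P - 1)
  have h2 := norm_mul_le ((2 : ℝ) • P - 1) A
  have h3 := norm_sub_le (A * ((2 : ℝ) • P - 1)) (((2 : ℝ) • P - 1) * A)
  have h4 := norm_symmetry_le hP
  rw [h, norm_smul, Real.norm_of_nonneg (by norm_num)]
  nlinarith [norm_nonneg A]

/-- The final projection of a partial isometry. -/
theorem mul_star_mem_projections {V : H →L[ℂ] H} (hV : V ∈ partialIsometries H) :
    V * star V ∈ projections H where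
  isIdempotentElem := by
    have : V * star V * V = V := hV
    rw [IsIdempotentElem, ← mul_assoc, this]
  isSelfAdjoint := .mul_star_self V

theorem enorm_le_quotientMetric {V T : H →L[ℂ] H} (hV : V ∈ partialIsometries H) :
    ‖T * star V + V * star T‖ₑ ≤ quotientMetric V T := by
  refine le_iInf₂ fun L hL => ?_
  obtain ⟨hA, hB, rfl⟩ := hL
  have h : (Complex.I • (L.1 * V) - Complex.I • (V * L.2)) * star V +
      V * star (Complex.I • (L.1 * V) - Complex.I • (V * L.2)) =
      Complex.I • (L.1 * (V * star V) - V * star V * L.1) := by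
    simp only [star_sub, star_smul, star_mul, hA.star_eq, hB.star_eq, RCLike.star_def,
      Complex.conj_I, mul_sub, sub_mul, smul_mul_assoc, mul_smul_comm, mul_assoc]
    module
  rw [h]
  refine enorm_le_iff_norm_le.2 ?_
  rw [norm_smul, Complex.norm_I, one_mul]
  exact (norm_commutator_le (mul_star_mem_projections hV) _).trans (norm_fst_le L)

theorem quotientMetric_le {V T A : H →L[ℂ] H} (hA : IsSelfAdjoint A)
    (hT : Complex.I • (A * V) - Complex.I • (V * A) = T) : quotientMetric V T ≤ ‖A‖ₑ := by
  refine (iInf₂_le (A, A) ⟨hA, hA, hT⟩).trans (enorm_le_iff_norm_le.2 ?_)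
  simp [Prod.norm_def]

theorem quotientMetric_le_of_tangent {P T : H →L[ℂ] H} (hP : P ∈ projections H)
    (hT : IsSelfAdjoint T) (h : T * P + P * T = T) : quotientMetric P T ≤ ‖T‖ₑ := by
  have hPP : P * P = P := hP.isIdempotentElem
  have hPTP : P * (T * P) = 0 := by
    have := congrArg (P * ·) h
    simpa only [mul_add, ← mul_assoc, hPP, add_eq_right] using this
  refine (quotientMetric_le (A := -Complex.I • (T * P - P * T)) ?_ ?_).trans
    (enorm_le_iff_norm_le.2 ?_)
  · rw [IsSelfAdjoint, star_smul, star_sub, star_mul, star_mul, hT.star_eq,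
      hP.isSelfAdjoint.star_eq]
    simp only [star_neg, RCLike.star_def, Complex.conj_I]
    module
  · have : (T * P - P * T) * P - P * (T * P - P * T) = T * P + P * T - (2 : ℂ) • (P * (T * P)) := by
      simp only [mul_sub, sub_mul, mul_assoc, hPP]
      simp only [← mul_assoc, hPP]
      module
    rw [smul_mul_assoc, mul_smul_comm, ← smul_sub, ← smul_sub, this, hPTP, h, smul_smul]
    simp
  · rw [norm_smul, norm_neg, Complex.norm_I, one_mul]
    exact norm_commutator_le hP T

section Curves

variable {a b : ℝ} {P Q : H →L[ℂ] H} {η γ : ℝ → H →L[ℂ] H}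

theorem curveLength_quotientMetric_le (h : IsSmoothCurve (projections H) a b P Q η) :
    curveLength quotientMetric a b η ≤ curveLength normMetric a b η := by
  refine curveLength_mono fun t ht => ?_
  have hd := h.hasDerivWithinAt ht
  have hu : UniqueDiffWithinAt ℝ (Set.Icc a b) t := uniqueDiffOn_Icc h.lt t ht
  refine quotientMetric_le_of_tangent (h.mem t ht) ?_ ?_
  · exact hu.eq_deriv _ hd.star (hd.congr (fun s hs => (h.mem s hs).isSelfAdjoint.star_eq)
      (h.mem t ht).isSelfAdjoint.star_eq)
  · exact hu.eq_deriv _ (hd.mul hd) (hd.congr (fun s hs => (h.mem s hs).isIdempotentElem.eq)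
      (h.mem t ht).isIdempotentElem.eq)

/-- The final projections of a curve of partial isometries form a curve of projections. -/
theorem IsSmoothCurve.mul_star (h : IsSmoothCurve (partialIsometries H) a b P Q γ) :
    IsSmoothCurve (projections H) a b (P * star P) (Q * star Q) fun t => γ t * star (γ t) where
  lt := h.lt
  smooth := h.smooth.mul ((starL' ℝ : (H →L[ℂ] H) ≃L[ℝ] (H →L[ℂ] H)).contDiff.comp_contDiffOn
    h.smooth)
  mem t ht := mul_star_mem_projections (h.mem t ht)
  left := by rw [h.left]
  right := by rw [h.right]

theorem curveLength_mul_star_le (h : IsSmoothCurve (partialIsometries H) a b P Q γ) :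
    curveLength normMetric a b (fun t => γ t * star (γ t)) ≤ curveLength quotientMetric a b γ := by
  refine curveLength_mono fun t ht => ?_
  have hd := h.hasDerivWithinAt ht
  have hd' : HasDerivWithinAt (fun t => γ t * star (γ t)) _ _ t := hd.mul hd.star
  rw [hd'.derivWithin (uniqueDiffOn_Icc h.lt t ht)]
  exact enorm_le_quotientMetric (h.mem t ht)

/-- A curve of projections of length `L` moves the symmetry `2P - 1` by at most `2 sin L`. -/
theorem norm_symmetry_sub_le (h : IsSmoothCurve (projections H) a b P Q η) {L : ℝ} (hL0 : 0 ≤ L)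
    (hL : L ≤ Real.pi / 2) (hle : curveLength normMetric a b η ≤ ENNReal.ofReal L) :
    ‖((2 : ℝ) • Q - 1) - ((2 : ℝ) • P - 1)‖ ≤ 2 * Real.sin L := by
  have hsin : 0 ≤ Real.sin L := Real.sin_nonneg_of_nonneg_of_le_pi hL0 (by linarith [Real.pi_pos])
  refine ContinuousLinearMap.opNorm_le_of_unit_norm (by positivity) fun x hx => ?_
  have hc : ContDiffOn ℝ 1 (fun t => ((2 : ℝ) • η t - 1) x) (Set.Icc a b) := by
    have h1 : ContDiffOn ℝ 1 (fun t => (2 : ℝ) • η t - 1) (Set.Icc a b) :=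
      ((h.smooth.of_le (by exact_mod_cast le_top)).const_smul (2 : ℝ)).sub contDiffOn_const
    exact ((ContinuousLinearMap.apply ℂ H x).restrictScalars ℝ).contDiff.comp_contDiffOn h1
  have hn : ∀ t ∈ Set.Icc a b, ‖((2 : ℝ) • η t - 1) x‖ = 1 := fun t ht => by
    rw [norm_symmetry_apply (h.mem t ht), hx]
  let _ : InnerProductSpace ℝ H := InnerProductSpace.rclikeToReal ℂ H
  have hS := ofReal_arccos_inner_le_lintegral h.lt hc hn
  have hbound : ∫⁻ t in Set.Icc a b,
      ‖derivWithin (fun t => ((2 : ℝ) • η t - 1) x) (Set.Icc a b) t‖ₑ ≤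
      ENNReal.ofReal (2 * L) := by
    rw [ENNReal.ofReal_mul zero_le_two]
    refine le_trans ?_ (mul_le_mul_right hle _)
    rw [curveLength, ← MeasureTheory.lintegral_const_mul' _ _ ENNReal.ofReal_ne_top]
    refine MeasureTheory.setLIntegral_mono' measurableSet_Icc fun t ht => ?_
    have hd := ((h.hasDerivWithinAt ht).const_smul (2 : ℝ)).sub_const 1
    have hd' : HasDerivWithinAt (fun t => ((2 : ℝ) • η t - 1) x) _ _ t :=
      ((ContinuousLinearMap.apply ℂ H x).restrictScalars ℝ).hasFDerivAt.comp_hasDerivWithinAt t hd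
    rw [hd'.derivWithin (uniqueDiffOn_Icc h.lt t ht), normMetric, ← ofReal_norm, ← ofReal_norm,
      ← ENNReal.ofReal_mul zero_le_two]
    refine ENNReal.ofReal_le_ofReal ?_
    change ‖((2 : ℝ) • derivWithin η (Set.Icc a b) t) x‖ ≤ _
    refine (ContinuousLinearMap.le_opNorm _ x).trans ?_
    rw [hx, mul_one, norm_smul, Real.norm_of_nonneg zero_le_two]
  have hang := (ENNReal.ofReal_le_ofReal_iff (by positivity)).1 (hS.trans hbound)
  have hpi : 2 * L ≤ Real.pi := by linarith
  have ha := hn a (Set.left_mem_Icc.2 h.lt.le)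
  have hb := hn b (Set.right_mem_Icc.2 h.lt.le)
  simp only [h.left, h.right] at hang ha hb
  have hin := abs_le.1 (abs_real_inner_le_norm (((2 : ℝ) • P - 1) x) (((2 : ℝ) • Q - 1) x))
  rw [ha, hb] at hin
  have hcos := Real.cos_le_cos_of_nonneg_of_le_pi (Real.arccos_nonneg _) hpi hang
  rw [Real.cos_arccos (by linarith) (by linarith), Real.cos_two_mul] at hcos
  rw [sub_apply]
  refine abs_le_of_sq_le_sq' ?_ (by positivity) |>.2
  rw [norm_sub_sq_real, real_inner_comm, ha, hb]
  nlinarith [Real.sin_sq_add_cos_sq L]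

end Curves

section Geodesic

open NormedSpace

theorem two_mul_sin_norm_le {X : H →L[ℂ] H} (hX : IsSelfAdjoint X) (hle : ‖X‖ ≤ Real.pi / 2) :
    2 * Real.sin ‖X‖ ≤ ‖exp ((2 * Complex.I) • X) - 1‖ := by
  rcases subsingleton_or_nontrivial H with _ | _
  · simp [Subsingleton.elim X 0]
  obtain ⟨z, hz, hzn⟩ := spectrum.exists_nnnorm_eq_spectralRadius X
  rw [hX.spectralRadius_eq_nnnorm, ENNReal.coe_inj] at hzn
  have hzn' : ‖z‖ = ‖X‖ := congrArg NNReal.toReal hzn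
  have hre := hX.mem_spectrum_eq_re hz
  have hm : exp ((2 * Complex.I) • z) ∈ spectrum ℂ (exp ((2 * Complex.I) • X)) :=
    spectrum.exp_mem_exp _
      (spectrum.smul_mem_smul_iff (r := Units.mk0 (2 * Complex.I) (by simp)).2 hz)
  have hm' : exp ((2 * Complex.I) • z) - 1 ∈ spectrum ℂ (exp ((2 * Complex.I) • X) - 1) := by
    have := (spectrum.add_mem_add_iff (s := (-1 : ℂ))).2 hm
    simpa [sub_eq_add_neg, add_comm] using this
  refine le_trans (le_of_eq ?_) (spectrum.norm_le_norm_of_mem hm')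
  rw [← Complex.exp_eq_exp_ℂ, smul_eq_mul, hre,
    show 2 * Complex.I * (z.re : ℂ) = Complex.I * ((2 * z.re : ℝ) : ℂ) by push_cast; ring,
    Complex.norm_exp_I_mul_ofReal_sub_one, mul_div_cancel_left₀ _ two_ne_zero, norm_mul,
    Real.norm_of_nonneg zero_le_two, Real.norm_eq_abs, ← hzn', hre, Complex.norm_real,
    Real.norm_eq_abs, Complex.ofReal_re]
  rw [hre, Complex.norm_real, Real.norm_eq_abs] at hzn'
  rcases abs_cases z.re with ⟨h, h0⟩ | ⟨h, h0⟩
  · rw [h, abs_of_nonneg (Real.sin_nonneg_of_nonneg_of_le_pi h0 _)]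
    linarith [Real.pi_pos]
  · rw [h, ← abs_neg, ← Real.sin_neg,
      abs_of_nonneg (Real.sin_nonneg_of_nonneg_of_le_pi (by linarith) _)]
    linarith [Real.pi_pos]

/-- The geodesic with velocity `X` is no longer than any curve of projections with the same
endpoints. -/
theorem enorm_le_curveLength {X P : H →L[ℂ] H} (hX : IsSelfAdjoint X) (hP : P ∈ projections H)
    (h₁ : P * X * P = 0) (h₂ : (1 - P) * X * (1 - P) = 0) (hle : ‖X‖ ≤ Real.pi / 2)
    {a b : ℝ} {η : ℝ → H →L[ℂ] H}
    (h : IsSmoothCurve (projections H) a b P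
      (exp (Complex.I • X) * P * exp (-(Complex.I • X))) η) :
    ‖X‖ₑ ≤ curveLength normMetric a b η := by
  by_contra! hlt
  set S := (2 : ℝ) • P - 1 with hS
  have hpos : curveLength normMetric a b η ≠ ⊤ := (hlt.trans (enorm_lt_top)).ne
  set L := (curveLength normMetric a b η).toReal
  have hLX : L < ‖X‖ := by
    rw [← toReal_enorm]
    exact (ENNReal.toReal_lt_toReal hpos enorm_ne_top).2 hlt
  have hL0 : 0 ≤ L := ENNReal.toReal_nonneg
  have hup := norm_symmetry_sub_le h hL0 (hLX.le.trans hle) (ENNReal.ofReal_toReal hpos).ge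
  have hanti : X * P + P * X = X := by
    have : (1 - P) * X * (1 - P) = X - (X * P + P * X) + P * X * P := by noncomm_ring
    rw [h₂, h₁, add_zero] at this
    exact (sub_eq_zero.1 this.symm).symm
  have hsemi : SemiconjBy S (-(Complex.I • X)) (Complex.I • X) := by
    have : X * S + S * X = 0 := by
      have : X * S + S * X = (2 : ℝ) • (X * P + P * X - X) := by
        simp only [hS, mul_sub, sub_mul, smul_mul_assoc, mul_smul_comm, mul_one, one_mul]
        module
      rw [this, hanti, sub_self, smul_zero]
    rw [SemiconjBy, mul_neg, mul_smul_comm, smul_mul_assoc, ← smul_neg,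
      ← eq_neg_of_add_eq_zero_left this]
  let +nondep : NormedAlgebra ℚ (H →L[ℂ] H) := .restrictScalars ℚ ℂ _
  have hexp : exp (Complex.I • X) * exp (-(Complex.I • X)) = 1 := by
    rw [← exp_add_of_commute (Commute.refl _).neg_right, add_neg_cancel, exp_zero]
  have hQ : (2 : ℝ) • (exp (Complex.I • X) * P * exp (-(Complex.I • X))) - 1 =
      exp ((2 * Complex.I) • X) * S := by
    have h2 : exp ((2 * Complex.I) • X) = exp (Complex.I • X) * exp (Complex.I • X) := by
      rw [← exp_add_of_commute (Commute.refl _), ← add_smul, two_mul]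
    rw [h2, mul_assoc (exp (Complex.I • X)) _ S, ← hsemi.exp_right.eq, hS]
    simp only [mul_sub, sub_mul, smul_mul_assoc, mul_smul_comm, one_mul, ← mul_assoc, hexp]
  rw [hQ, ← hS] at hup
  have hlow := two_mul_sin_norm_le hX hle
  have heq : exp ((2 * Complex.I) • X) - 1 = (exp ((2 * Complex.I) • X) * S - S) * S := by
    rw [sub_mul, mul_assoc, symmetry_mul_self hP, mul_one]
  have hmul := norm_mul_le (exp ((2 * Complex.I) • X) * S - S) S
  rw [← heq] at hmul
  have hfin : Real.sin ‖X‖ ≤ Real.sin L := by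
    nlinarith [norm_symmetry_le hP, norm_nonneg (exp ((2 * Complex.I) • X) * S - S)]
  exact absurd (Real.strictMonoOn_sin ⟨by linarith [Real.pi_pos], by linarith⟩
    ⟨by linarith [norm_nonneg X, Real.pi_pos], hle⟩ hLX) hfin.not_gt

theorem curveLength_quotientMetric_exp_le {X P : H →L[ℂ] H} (hX : IsSelfAdjoint X)
    {δ : ℝ → H →L[ℂ] H}
    (hδ : ∀ t ∈ Set.Icc (0 : ℝ) 1, δ t = exp ((Complex.I * (t : ℂ)) • X) * P *
      exp (-((Complex.I * (t : ℂ)) • X))) :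
    curveLength quotientMetric 0 1 δ ≤ ‖X‖ₑ := by
  have h : ∀ t ∈ Set.Icc (0 : ℝ) 1,
      quotientMetric (δ t) (derivWithin δ (Set.Icc 0 1) t) ≤ ‖X‖ₑ := by
    intro t ht
    refine quotientMetric_le hX ?_
    have e : ∀ s : ℝ, (Complex.I * (s : ℂ)) • X = s • (Complex.I • X) := fun s => by
      rw [mul_comm, mul_smul, Complex.coe_smul]
    have hd : HasDerivAt (fun s : ℝ => exp (s • (Complex.I • X)) * P * exp (s • -(Complex.I • X)))
        _ t :=
      ((hasDerivAt_exp_smul_const' (Complex.I • X) t).mul_const P).mul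
        (hasDerivAt_exp_smul_const (-(Complex.I • X)) t)
    have hδ' : ∀ s ∈ Set.Icc (0 : ℝ) 1,
        δ s = exp (s • (Complex.I • X)) * P * exp (s • -(Complex.I • X)) := fun s hs => by
      rw [hδ s hs, e, smul_neg]
    rw [(hd.hasDerivWithinAt.congr hδ' (hδ' t ht)).derivWithin
      (uniqueDiffOn_Icc zero_lt_one t ht), hδ' t ht]
    simp only [mul_assoc, smul_mul_assoc, mul_smul_comm, mul_neg, sub_eq_add_neg]
  refine (MeasureTheory.setLIntegral_mono' measurableSet_Icc h).trans ?_
  simp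

end Geodesic

end PartialIsometries

theorem mainTheorem7 {H : Type*} [NormedAddCommGroup H] [InnerProductSpace ℂ H] [CompleteSpace H]
    (P₀ P₁ : H →L[ℂ] H)
    (hP₀ : P₀ ∈ PartialIsometries.projections H) (hP₁ : P₁ ∈ PartialIsometries.projections H)
    (hdim : PartialIsometries.SameCrossDim P₀ P₁)
    (δ : ℝ → H →L[ℂ] H)
    (hδ : PartialIsometries.IsShortGeodesic P₀ P₁ δ ∨
      PartialIsometries.IsMetricGeodesic P₀ P₁ δ)
    (a b : ℝ) (γ : ℝ → H →L[ℂ] H)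
    (hγ : PartialIsometries.IsSmoothCurve
      (PartialIsometries.partialIsometries H) a b P₀ P₁ γ) :
    PartialIsometries.curveLength PartialIsometries.quotientMetric 0 1 δ ≤
      PartialIsometries.curveLength PartialIsometries.quotientMetric a b γ := by
  have hp := hγ.mul_star
  rw [hP₀.isSelfAdjoint.star_eq, hP₀.isIdempotentElem.eq, hP₁.isSelfAdjoint.star_eq,
    hP₁.isIdempotentElem.eq] at hp
  refine le_trans ?_ (PartialIsometries.curveLength_mul_star_le hγ)
  rcases hδ with ⟨X, hX, h₁, h₂, hle, hδ, h1⟩ | ⟨hδ, hmin⟩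
  · have hP : P₁ = NormedSpace.exp (Complex.I • X) * P₀ * NormedSpace.exp (-(Complex.I • X)) := by
      rw [← h1, hδ 1 (by simp), Complex.ofReal_one, mul_one]
    subst hP
    exact (PartialIsometries.curveLength_quotientMetric_exp_le hX hδ).trans
      (PartialIsometries.enorm_le_curveLength hX hP₀ h₁ h₂ hle hp)
  · exact (PartialIsometries.curveLength_quotientMetric_le hδ).trans (hmin a b _ hp)
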